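/- There is an absolute constant $C>0$ such that for all real numbers $M,K,L>0$ and all complex numbers $a_{k,l}$ indexed by the positive integers $k\le K$ and $l\le L$, $$\sum_{M<m\le 2M}\ \sum_{\substack{\nu \bmod m\\ \nu^3\equiv 2\ (\mathrm{mod}\ m)}}\Bigl|\sum_{1\le k\le K}\ \sum_{1\le l\le L}a_{k,l}\,e\Bigl(\frac{k\nu+l\nu^2}{m}\Bigr)\Bigr|^2\ \le\ C\,(M+K)(M+L)\sum_{1\le k\le K}\ \sum_{1\le l\le L}|a_{k,l}|^2 ,$$ where $e(x)=e^{2\pi i x}$, $m$ runs over integers, and $\nu$ runs over the residue classes modulo $m$ with $\nu^3\equiv 2 \pmod m$. -/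

import Mathlib

namespace CubicSieve

/-- The additive character `e(x) = exp(2πix)`. -/
noncomputable def e (x : ℝ) : ℂ := Complex.exp (2 * Real.pi * Complex.I * x)

/-- The roots `ν (mod m)` of `X³ ≡ 2 (mod m)`, each residue class being represented by its
least non-negative element. -/
def roots (m : ℕ) : Finset ℕ := (Finset.range m).filter (fun ν => ν ^ 3 ≡ 2 [MOD m])

end CubicSieve

namespace CubicSieve

/-! The points `(ν/m, ν²/m)` are well spaced on the torus. Put `θ = ∛2`. The number `(2 + ν²θ +
νθ²)/m` lies in the inverse of the ideal `(m, θ - ν)` of norm `m`, so a difference of two such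
numbers, for `m` and `w`, has norm in `(1/(mw))ℤ` (`normForm_dvd`). If two points are within `1/M`
modulo 1, all coordinates of this difference, after an integral shift, are at most `1/M`; its norm
is `O(M⁻³)`, too small unless zero, so the points agree (`root_spacing`).

A large sieve for separated points then gives the bound. It is proved in `ℤ/Nℤ`, with `N` divisible
by every `m`, by averaging over disjoint boxes and Parseval (`large_sieve_zmod`). Bounded `M` needs
only Cauchy–Schwarz. -/

/-! ### Norm form and spacing of the roots -/

/-- The norm form of `ℤ[∛2]` is anisotropic. -/
lemma normForm_eq_zero (P Q R : ℤ) (h : P ^ 3 + 2 * Q ^ 3 + 4 * R ^ 3 = 6 * P * Q * R) :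
    P = 0 ∧ Q = 0 ∧ R = 0 := by
  induction hn : P.natAbs + Q.natAbs + R.natAbs using Nat.strong_induction_on
    generalizing P Q R with
  | _ n ih =>
    -- Infinite descent: 2 divides `P`, then `Q`, then `R`, and halving all three gives a smaller
    -- solution.
    have two : Prime (2 : ℤ) := Int.prime_two
    obtain ⟨p, rfl⟩ : (2 : ℤ) ∣ P :=
      two.dvd_of_dvd_pow (n := 3) ⟨3 * P * Q * R - Q ^ 3 - 2 * R ^ 3, by linarith⟩
    obtain ⟨q, rfl⟩ : (2 : ℤ) ∣ Q :=
      two.dvd_of_dvd_pow (n := 3) ⟨3 * p * Q * R - R ^ 3 - 2 * p ^ 3, by linarith⟩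
    obtain ⟨r, rfl⟩ : (2 : ℤ) ∣ R :=
      two.dvd_of_dvd_pow (n := 3) ⟨3 * p * q * R - p ^ 3 - 2 * q ^ 3, by linarith⟩
    by_cases h0 : p = 0 ∧ q = 0 ∧ r = 0
    · simp [h0]
    · obtain ⟨h1, h2, h3⟩ := ih (p.natAbs + q.natAbs + r.natAbs) (by omega) p q r
        (by linarith) rfl
      simp [h1, h2, h3]

/-- If `a³ ≡ 2 (mod m)` and `b³ ≡ 2 (mod w)`, then `m w` times the norm form at
`(2/m - 2/w, a²/m - b²/w - n, a/m - b/w)` is an integer. -/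
lemma normForm_dvd {m w a b : ℤ} (n : ℤ) (ha : m ∣ a ^ 3 - 2) (hb : w ∣ b ^ 3 - 2) :
    (m * w) ^ 2 ∣ (2 * w - 2 * m) ^ 3 + 2 * (a ^ 2 * w - b ^ 2 * m - n * m * w) ^ 3 +
      4 * (a * w - b * m) ^ 3 -
      6 * (2 * w - 2 * m) * (a ^ 2 * w - b ^ 2 * m - n * m * w) * (a * w - b * m) := by
  obtain ⟨t, ht⟩ := ha
  obtain ⟨s, hs⟩ := hb
  refine ⟨2 * w * t ^ 2 - 6 * t * (a * b ^ 2 + a * n * w - 2) +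
    (-12 * (s + b * n) + 6 * a ^ 2 * (b * s + 2 * b ^ 2 * n + n ^ 2 * w) - 12 * n * a) -
    m * (2 * s ^ 2 + 6 * b * n * s + 6 * b ^ 2 * n ^ 2 + 2 * n ^ 3 * w), ?_⟩
  -- Grouping by `a³ - 2` and `b³ - 2` makes each of the four terms visibly divisible by `m²w²`.
  have key : (2 * w - 2 * m) ^ 3 + 2 * (a ^ 2 * w - b ^ 2 * m - n * m * w) ^ 3 +
      4 * (a * w - b * m) ^ 3 -
      6 * (2 * w - 2 * m) * (a ^ 2 * w - b ^ 2 * m - n * m * w) * (a * w - b * m) =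
      2 * w ^ 3 * (a ^ 3 - 2) ^ 2
        - 6 * w ^ 2 * m * (a ^ 3 - 2) * (a * b ^ 2 + a * n * w - 2)
        + m ^ 2 * w * (-12 * ((b ^ 3 - 2) + b * n * w)
          + 6 * a ^ 2 * (b * (b ^ 3 - 2) + 2 * b ^ 2 * n * w + n ^ 2 * w ^ 2) - 12 * n * a * w)
        - m ^ 3 * (2 * (b ^ 3 - 2) ^ 2 + 6 * b * n * w * (b ^ 3 - 2)
          + 6 * b ^ 2 * n ^ 2 * w ^ 2 + 2 * n ^ 3 * w ^ 3) := by ring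
  rw [key, ht, hs]
  ring

/-- Distinct points `(ν/m, ν²/m)` with `M < m ≤ 2M` are `1/M`-separated modulo `1`. -/
lemma root_spacing {M : ℝ} (hM : 52 < M) {m w a b : ℤ} (hm : M < m) (hm' : m ≤ 2 * M)
    (hw : M < w) (hw' : w ≤ 2 * M) (ha : m ∣ a ^ 3 - 2) (hb : w ∣ b ^ 3 - 2) (i j : ℤ)
    (h1 : |(a : ℝ) / m - b / w - i| ≤ 1 / M) (h2 : |(a : ℝ) ^ 2 / m - b ^ 2 / w - j| ≤ 1 / M) :
    m = w ∧ m ∣ a - b := by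
  have hM0 : 0 < M := by linarith
  have hm0 : (0 : ℝ) < m := by linarith
  have hw0 : (0 : ℝ) < w := by linarith
  have ha' : m ∣ (a - i * m) ^ 3 - 2 := by
    have : (a - i * m) ^ 3 - 2 =
      (a ^ 3 - 2) + m * (-3 * a ^ 2 * i + 3 * a * i ^ 2 * m - i ^ 3 * m ^ 2) := by ring
    rw [this]; exact dvd_add ha (dvd_mul_right _ _)
  -- Replacing `a` by `c` absorbs `i`; `n` corrects `j` for the resulting change in the square.
  set c : ℤ := a - i * m with hc
  set n : ℤ := j - 2 * i * a + i ^ 2 * m with hn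
  have hr : (a : ℝ) / m - b / w - i = (c : ℝ) / m - b / w := by
    rw [hc]; push_cast; field_simp; ring
  have hq : (a : ℝ) ^ 2 / m - b ^ 2 / w - j = (c : ℝ) ^ 2 / m - b ^ 2 / w - n := by
    rw [hc, hn]; push_cast; field_simp; ring
  rw [hr] at h1
  rw [hq] at h2
  obtain ⟨z, hz⟩ := normForm_dvd n ha' hb
  set p : ℝ := 2 / m - 2 / w with hp
  set q : ℝ := (c : ℝ) ^ 2 / m - b ^ 2 / w - n with hqd
  set r : ℝ := (c : ℝ) / m - b / w with hrd
  -- Both `2/m` and `2/w` lie in `[1/M, 2/M]`; this uses the dyadic range.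
  have hp1 : |p| ≤ 1 / M := by
    have e1 : (2 : ℝ) / m ≤ 2 / M := by gcongr
    have e2 : (2 : ℝ) / w ≤ 2 / M := by gcongr
    have e3 : 2 / (2 * M) ≤ (2 : ℝ) / m := by gcongr
    have e4 : 2 / (2 * M) ≤ (2 : ℝ) / w := by gcongr
    have e5 : 2 / (2 * M) = 1 / M := by field_simp
    have e6 : 2 / M = 2 * (1 / M) := by ring
    rw [abs_le]; constructor <;> linarith
  have hF : (m : ℝ) * w * (p ^ 3 + 2 * q ^ 3 + 4 * r ^ 3 - 6 * p * q * r) = z := by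
    have hz' : ((2 * w - 2 * m) ^ 3 + 2 * (c ^ 2 * w - b ^ 2 * m - n * m * w) ^ 3 +
      4 * (c * w - b * m) ^ 3 -
      6 * (2 * w - 2 * m) * (c ^ 2 * w - b ^ 2 * m - n * m * w) * (c * w - b * m) : ℝ) =
      (m * w) ^ 2 * z := by exact_mod_cast hz
    have e1 : (2 * w - 2 * m : ℝ) = m * w * p := by rw [hp]; field_simp
    have e2 : (c ^ 2 * w - b ^ 2 * m - n * m * w : ℝ) = m * w * q := by rw [hqd]; field_simp
    have e3 : (c * w - b * m : ℝ) = m * w * r := by rw [hrd]; field_simp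
    rw [e1, e2, e3] at hz'
    have : (m * w : ℝ) ^ 2 ≠ 0 := by positivity
    apply mul_left_cancel₀ this
    rw [← hz']; ring
  -- `13 = 1 + 2 + 4 + 6`; with `mw ≤ 4M²` this produces the threshold 52.
  have hb3 : |p ^ 3 + 2 * q ^ 3 + 4 * r ^ 3 - 6 * p * q * r| ≤ 13 * (1 / M) ^ 3 := by
    have e1 : |p ^ 3| ≤ (1 / M) ^ 3 := by rw [abs_pow]; gcongr
    have e2 : |q ^ 3| ≤ (1 / M) ^ 3 := by rw [abs_pow]; gcongr
    have e3 : |r ^ 3| ≤ (1 / M) ^ 3 := by rw [abs_pow]; gcongr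
    have e4 : |p * q * r| ≤ (1 / M) ^ 3 := by
      rw [abs_mul, abs_mul, pow_three, ← mul_assoc]; gcongr
    rw [abs_le] at *
    constructor <;> linarith
  have hz1 : |(z : ℝ)| < 1 := by
    rw [← hF, abs_mul, abs_of_pos (by positivity : (0 : ℝ) < m * w)]
    calc (m : ℝ) * w * |p ^ 3 + 2 * q ^ 3 + 4 * r ^ 3 - 6 * p * q * r|
        ≤ (2 * M) * (2 * M) * (13 * (1 / M) ^ 3) := by gcongr
      _ = 52 / M := by field_simp; norm_num
      _ < 1 := by rw [div_lt_one hM0]; exact hM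
  have hz0 : z = 0 := by
    rw [← Int.abs_lt_one_iff]; exact_mod_cast hz1
  rw [hz0, mul_zero] at hz
  obtain ⟨k1, k2, k3⟩ := normForm_eq_zero _ _ _ (sub_eq_zero.mp hz)
  have hmw : m = w := by linarith
  refine ⟨hmw, ?_⟩
  have hm0' : m ≠ 0 := by rintro rfl; simp at hm0
  rw [← hmw] at k3
  have : c = b := by
    apply mul_right_cancel₀ hm0'; linarith
  exact ⟨i, by rw [← this, hc]; ring⟩

/-! ### Parseval and the large sieve modulo `N` -/

open ZMod

/-- Since `K ≤ N`, the frequencies are distinct modulo `N` and their characters orthogonal. -/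
lemma parseval_zmod {N : ℕ} [NeZero N] {K : ℕ} (hK : K ≤ N) (b : ℕ → ℂ) :
    ∑ x : ZMod N, ‖∑ k ∈ Finset.Icc 1 K, b k * stdAddChar ((k : ZMod N) * x)‖ ^ 2 =
      N * ∑ k ∈ Finset.Icc 1 K, ‖b k‖ ^ 2 := by
  have horth : ∀ k ∈ Finset.Icc 1 K, ∀ l ∈ Finset.Icc 1 K,
      ∑ x : ZMod N, stdAddChar ((k : ZMod N) * x) * (starRingEnd ℂ) (stdAddChar ((l : ZMod N) * x))
        = if l = k then (N : ℂ) else 0 := by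
    intro k hk l hl
    have h1 : ∀ x : ZMod N, stdAddChar ((k : ZMod N) * x) *
        (starRingEnd ℂ) (stdAddChar ((l : ZMod N) * x)) =
        stdAddChar (x * ((k : ZMod N) - (l : ZMod N))) := by
      intro x
      rw [← AddChar.map_neg_eq_conj, ← AddChar.map_add_eq_mul]
      congr 1; ring
    rw [Finset.sum_congr rfl fun x _ => h1 x, AddChar.sum_mulShift _ (isPrimitive_stdAddChar N)]
    have h2 : ((k : ZMod N) - (l : ZMod N) = 0) ↔ l = k := by
      rw [sub_eq_zero, ZMod.natCast_eq_natCast_iff]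
      constructor
      · intro h
        rw [Finset.mem_Icc] at hk hl
        have h3 := (Nat.modEq_iff_dvd.mp h)
        have : (l : ℤ) - k = 0 := Int.eq_zero_of_abs_lt_dvd h3 (by rw [abs_lt]; omega)
        omega
      · rintro rfl; rfl
    simp only [h2, ZMod.card]
    split_ifs <;> simp
  have hC : ((∑ x : ZMod N, ‖∑ k ∈ Finset.Icc 1 K, b k * stdAddChar ((k : ZMod N) * x)‖ ^ 2 : ℝ)
      : ℂ) = ((N * ∑ k ∈ Finset.Icc 1 K, ‖b k‖ ^ 2 : ℝ) : ℂ) := by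
    push_cast
    simp only [← Complex.mul_conj', map_sum, map_mul, Finset.sum_mul_sum]
    rw [Finset.sum_comm, Finset.mul_sum]
    refine Finset.sum_congr rfl fun k hk => ?_
    rw [Finset.sum_comm]
    calc _ = ∑ l ∈ Finset.Icc 1 K, b k * (starRingEnd ℂ) (b l) *
          (if l = k then (N : ℂ) else 0) := by
          refine Finset.sum_congr rfl fun l hl => ?_
          rw [← horth k hk l hl, Finset.mul_sum]
          refine Finset.sum_congr rfl fun x _ => ?_
          ring
      _ = _ := by
          simp only [mul_ite, mul_zero, Finset.sum_ite_eq', hk, if_true]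
          ring
  exact_mod_cast hC

lemma parseval_zmod_two {N : ℕ} [NeZero N] {K L : ℕ} (hK : K ≤ N) (hL : L ≤ N)
    (b : ℕ → ℕ → ℂ) :
    ∑ z : ZMod N × ZMod N, ‖∑ k ∈ Finset.Icc 1 K, ∑ l ∈ Finset.Icc 1 L,
      b k l * stdAddChar ((k : ZMod N) * z.1 + (l : ZMod N) * z.2)‖ ^ 2 =
      N ^ 2 * ∑ k ∈ Finset.Icc 1 K, ∑ l ∈ Finset.Icc 1 L, ‖b k l‖ ^ 2 := by
  have h1 : ∀ x y : ZMod N, ∑ k ∈ Finset.Icc 1 K, ∑ l ∈ Finset.Icc 1 L,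
      b k l * stdAddChar ((k : ZMod N) * x + (l : ZMod N) * y) =
      ∑ k ∈ Finset.Icc 1 K, (∑ l ∈ Finset.Icc 1 L, b k l * stdAddChar ((l : ZMod N) * y)) *
        stdAddChar ((k : ZMod N) * x) := by
    intro x y
    refine Finset.sum_congr rfl fun k _ => ?_
    rw [Finset.sum_mul]
    refine Finset.sum_congr rfl fun l _ => ?_
    rw [AddChar.map_add_eq_mul]; ring
  rw [Fintype.sum_prod_type_right]
  simp only [h1, parseval_zmod hK]
  rw [← Finset.mul_sum, Finset.sum_comm]
  simp only [parseval_zmod hL]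
  rw [← Finset.mul_sum]; ring

/-- A short geometric sum of additive characters does not cancel. -/
lemma half_le_norm_sum_stdAddChar {N : ℕ} [NeZero N] {k T : ℕ} (h : 6 * k * T ≤ N) :
    (T : ℝ) / 2 ≤ ‖∑ t ∈ Finset.range T, stdAddChar ((k : ZMod N) * (t : ZMod N))‖ := by
  refine le_trans ?_ (Complex.re_le_norm _)
  rw [Complex.re_sum]
  have hN : (0 : ℝ) < N := by exact_mod_cast Nat.pos_of_ne_zero (NeZero.ne N)
  have h1 : ∀ t ∈ Finset.range T, (1 / 2 : ℝ) ≤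
      (stdAddChar ((k : ZMod N) * (t : ZMod N)) : ℂ).re := by
    intro t ht
    have e1 : ((k : ZMod N) * (t : ZMod N)) = (((k * t : ℕ) : ℤ) : ZMod N) := by push_cast; rfl
    have e2 : (2 * Real.pi * Complex.I * (((k * t : ℕ) : ℤ) : ℂ) / N : ℂ) =
        ((2 * Real.pi * (k * t) / N : ℝ) : ℂ) * Complex.I := by push_cast; ring
    -- Every phase is at most `π/3`, so every real part is at least `1/2`.
    rw [e1, stdAddChar_coe, e2, Complex.exp_ofReal_mul_I_re, ← Real.cos_pi_div_three]
    have ht' : 6 * ((k : ℝ) * t) ≤ N := by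
      have : 6 * (k * t) ≤ N := by
        refine le_trans ?_ h
        rw [← mul_assoc]
        exact Nat.mul_le_mul_left _ (Finset.mem_range.mp ht).le
      exact_mod_cast this
    apply Real.cos_le_cos_of_nonneg_of_le_pi
    · positivity
    · linarith [Real.pi_pos]
    · rw [div_le_iff₀ hN]
      nlinarith [Real.pi_pos]
  calc (T : ℝ) / 2 = ∑ t ∈ Finset.range T, (1 / 2 : ℝ) := by simp; ring
    _ ≤ _ := Finset.sum_le_sum h1

/-- A two-dimensional large sieve over `ℤ/Nℤ`, for points whose translates of a fixed `T × U` box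
are disjoint. -/
lemma large_sieve_zmod {ι : Type*} {N : ℕ} [NeZero N] {K L T U : ℕ} (hT : 0 < T) (hU : 0 < U)
    (hK : 6 * K * T ≤ N) (hL : 6 * L * U ≤ N) (S : Finset ι) (X Y : ι → ZMod N)
    (hinj : Set.InjOn (fun z : ι × ℕ × ℕ => (X z.1 + (z.2.1 : ZMod N), Y z.1 + (z.2.2 : ZMod N)))
      (S ×ˢ (Finset.range T ×ˢ Finset.range U) : Finset (ι × ℕ × ℕ)))
    (a : ℕ → ℕ → ℂ) :
    ∑ s ∈ S, ‖∑ k ∈ Finset.Icc 1 K, ∑ l ∈ Finset.Icc 1 L,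
      a k l * stdAddChar ((k : ZMod N) * X s + (l : ZMod N) * Y s)‖ ^ 2 ≤
      16 * ((N : ℝ) / T) * (N / U) * ∑ k ∈ Finset.Icc 1 K, ∑ l ∈ Finset.Icc 1 L, ‖a k l‖ ^ 2 := by
  have hT' : (0 : ℝ) < T := by exact_mod_cast hT
  have hU' : (0 : ℝ) < U := by exact_mod_cast hU
  set c : ℕ → ℂ := fun k => ∑ t ∈ Finset.range T, stdAddChar ((k : ZMod N) * (t : ZMod N)) with hc
  set d : ℕ → ℂ := fun l => ∑ u ∈ Finset.range U, stdAddChar ((l : ZMod N) * (u : ZMod N)) with hd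
  have hcb : ∀ k ∈ Finset.Icc 1 K, (T : ℝ) / 2 ≤ ‖c k‖ := fun k hk =>
    half_le_norm_sum_stdAddChar (le_trans (by gcongr; exact (Finset.mem_Icc.mp hk).2) hK)
  have hdb : ∀ l ∈ Finset.Icc 1 L, (U : ℝ) / 2 ≤ ‖d l‖ := fun l hl =>
    half_le_norm_sum_stdAddChar (le_trans (by gcongr; exact (Finset.mem_Icc.mp hl).2) hL)
  -- Dividing by the box multiplier `c k * d l` makes the original sum at a point equal to the sum
  -- of `F` over the box based there.
  set b : ℕ → ℕ → ℂ := fun k l => a k l / (c k * d l) with hb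
  set F : ZMod N × ZMod N → ℂ := fun z => ∑ k ∈ Finset.Icc 1 K, ∑ l ∈ Finset.Icc 1 L,
      b k l * stdAddChar ((k : ZMod N) * z.1 + (l : ZMod N) * z.2) with hF
  have hab : ∀ k ∈ Finset.Icc 1 K, ∀ l ∈ Finset.Icc 1 L, a k l = b k l * (c k * d l) := by
    intro k hk l hl
    have h1 : c k ≠ 0 := norm_pos_iff.mp (lt_of_lt_of_le (by positivity) (hcb k hk))
    have h2 : d l ≠ 0 := norm_pos_iff.mp (lt_of_lt_of_le (by positivity) (hdb l hl))
    simp only [hb]; field_simp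
  have hbn : ∀ k ∈ Finset.Icc 1 K, ∀ l ∈ Finset.Icc 1 L,
      ‖b k l‖ ^ 2 ≤ 16 / (T * U : ℝ) ^ 2 * ‖a k l‖ ^ 2 := by
    intro k hk l hl
    have h1 : (T : ℝ) / 2 * (U / 2) ≤ ‖c k‖ * ‖d l‖ := by
      gcongr
      · exact hcb k hk
      · exact hdb l hl
    have h2 : ‖b k l‖ ≤ 4 / (T * U : ℝ) * ‖a k l‖ := by
      simp only [hb, norm_div, norm_mul]
      calc ‖a k l‖ / (‖c k‖ * ‖d l‖) ≤ ‖a k l‖ / ((T : ℝ) / 2 * (U / 2)) := by gcongr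
        _ = _ := by field_simp; norm_num
    calc ‖b k l‖ ^ 2 ≤ (4 / (T * U : ℝ) * ‖a k l‖) ^ 2 := by gcongr
      _ = _ := by ring
  have hbox : ∀ s, ∑ k ∈ Finset.Icc 1 K, ∑ l ∈ Finset.Icc 1 L,
      a k l * stdAddChar ((k : ZMod N) * X s + (l : ZMod N) * Y s) =
      ∑ w ∈ Finset.range T ×ˢ Finset.range U, F (X s + (w.1 : ZMod N), Y s + (w.2 : ZMod N)) := by
    intro s
    simp only [hF]
    rw [Finset.sum_comm (s := Finset.range T ×ˢ Finset.range U)]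
    refine Finset.sum_congr rfl fun k hk => ?_
    rw [Finset.sum_comm (s := Finset.range T ×ˢ Finset.range U)]
    refine Finset.sum_congr rfl fun l hl => ?_
    rw [hab k hk l hl, Finset.sum_product]
    simp only [hc, hd]
    rw [Finset.sum_mul_sum, Finset.mul_sum, Finset.sum_mul]
    refine Finset.sum_congr rfl fun t _ => ?_
    rw [Finset.mul_sum, Finset.sum_mul]
    refine Finset.sum_congr rfl fun u _ => ?_
    simp only [mul_add, AddChar.map_add_eq_mul]
    ring
  have hKN : K ≤ N := le_trans (by nlinarith) hK
  have hLN : L ≤ N := le_trans (by nlinarith) hL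
  calc ∑ s ∈ S, ‖∑ k ∈ Finset.Icc 1 K, ∑ l ∈ Finset.Icc 1 L,
        a k l * stdAddChar ((k : ZMod N) * X s + (l : ZMod N) * Y s)‖ ^ 2
      ≤ ∑ s ∈ S, (T * U : ℝ) * ∑ w ∈ Finset.range T ×ˢ Finset.range U,
          ‖F (X s + (w.1 : ZMod N), Y s + (w.2 : ZMod N))‖ ^ 2 := by
        refine Finset.sum_le_sum fun s _ => ?_
        rw [hbox s]
        calc _ ≤ (∑ w ∈ Finset.range T ×ˢ Finset.range U,
              ‖F (X s + (w.1 : ZMod N), Y s + (w.2 : ZMod N))‖) ^ 2 := by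
              gcongr; exact norm_sum_le _ _
          _ ≤ _ := by
              refine le_trans sq_sum_le_card_mul_sum_sq (le_of_eq ?_)
              simp
    _ = (T * U : ℝ) * ∑ z ∈ (S ×ˢ (Finset.range T ×ˢ Finset.range U) : Finset (ι × ℕ × ℕ)).image
          (fun z : ι × ℕ × ℕ => (X z.1 + (z.2.1 : ZMod N), Y z.1 + (z.2.2 : ZMod N))),
          ‖F z‖ ^ 2 := by
        rw [Finset.sum_image hinj, Finset.sum_product, Finset.mul_sum]
    _ ≤ (T * U : ℝ) * ∑ z, ‖F z‖ ^ 2 := by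
        gcongr
        exact Finset.subset_univ _
    _ = (T * U : ℝ) * (N ^ 2 * ∑ k ∈ Finset.Icc 1 K, ∑ l ∈ Finset.Icc 1 L, ‖b k l‖ ^ 2) := by
        rw [← parseval_zmod_two hKN hLN b]
    _ ≤ (T * U : ℝ) * (N ^ 2 * ∑ k ∈ Finset.Icc 1 K, ∑ l ∈ Finset.Icc 1 L,
          16 / (T * U : ℝ) ^ 2 * ‖a k l‖ ^ 2) := by
        gcongr with k hk l hl
        exact hbn k hk l hl
    _ = _ := by
        simp only [← Finset.mul_sum]
        field_simp

/-! ### From the torus to residues modulo `N` -/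

/-- If two translates meet, the fractions differ modulo 1 by `(t' - t)/N`, and `T/N = 1/A`. -/
lemma exists_int_close_of_add_eq {N A T m w u v t t' : ℕ} (hN : N = T * A) (hN0 : 0 < N)
    (hm : m ∣ N) (hw : w ∣ N) (ht : t < T) (ht' : t' < T)
    (h : ((u * (N / m) : ℕ) : ZMod N) + (t : ZMod N) =
      ((v * (N / w) : ℕ) : ZMod N) + (t' : ZMod N)) :
    ∃ i : ℤ, |(u : ℝ) / m - v / w - i| ≤ 1 / A := by
  have h' : ((u * (N / m) + t : ℕ) : ZMod N) = ((v * (N / w) + t' : ℕ) : ZMod N) := by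
    rw [Nat.cast_add, Nat.cast_add]; exact h
  rw [ZMod.natCast_eq_natCast_iff] at h'
  obtain ⟨i, hi⟩ := Nat.modEq_iff_dvd.mp h'
  have hN' : (0 : ℝ) < N := by exact_mod_cast hN0
  have hm0 : 0 < m := Nat.pos_of_dvd_of_pos hm hN0
  have hw0 : 0 < w := Nat.pos_of_dvd_of_pos hw hN0
  have hm1 : (m : ℝ) ≠ 0 := by exact_mod_cast hm0.ne'
  have hw1 : (w : ℝ) ≠ 0 := by exact_mod_cast hw0.ne'
  have hi' : ((v : ℝ) * (N / w) + t') - (u * (N / m) + t) = N * i := by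
    have : (((v * (N / w) + t' : ℕ) : ℤ) : ℝ) - ((u * (N / m) + t : ℕ) : ℤ) = N * i := by
      exact_mod_cast hi
    rw [Int.cast_natCast, Int.cast_natCast] at this
    push_cast [Nat.cast_div hm hm1, Nat.cast_div hw hw1] at this
    exact this
  refine ⟨-i, ?_⟩
  have hA : (1 : ℝ) / A = T / N := by
    have hT0 : (T : ℝ) ≠ 0 := by exact_mod_cast (by omega : T ≠ 0)
    rw [hN]; push_cast; field_simp
  have e : (u : ℝ) / m - v / w - ((-i : ℤ) : ℝ) = (t' - t) / N := by
    push_cast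
    rw [eq_div_iff hN'.ne']
    have e1 : (u : ℝ) / m * N = u * (N / m) := by ring
    have e2 : (v : ℝ) / w * N = v * (N / w) := by ring
    linarith
  rw [e, hA, abs_div, abs_of_pos hN']
  gcongr
  have : (t : ℝ) < T := by exact_mod_cast ht
  have : (t' : ℝ) < T := by exact_mod_cast ht'
  have : (0 : ℝ) ≤ t := by positivity
  have : (0 : ℝ) ≤ t' := by positivity
  rw [abs_le]; constructor <;> linarith

lemma natCast_add_left_cancel {N T t t' : ℕ} {x : ZMod N} (hT : T ≤ N) (ht : t < T) (ht' : t' < T)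
    (h : x + (t : ZMod N) = x + (t' : ZMod N)) : t = t' := by
  have := add_left_cancel h
  rw [ZMod.natCast_eq_natCast_iff] at this
  exact this.eq_of_lt_of_lt (by omega) (by omega)

lemma dvd_of_mem_roots {m ν : ℕ} (h : ν ∈ roots m) : (m : ℤ) ∣ (ν : ℤ) ^ 3 - 2 := by
  have := (Finset.mem_filter.mp h).2
  have := Nat.modEq_iff_dvd.mp this.symm
  exact_mod_cast this

lemma norm_e (x : ℝ) : ‖e x‖ = 1 := by
  have : e x = Complex.exp (((2 * Real.pi * x : ℝ) : ℂ) * Complex.I) := by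
    unfold e; push_cast; ring_nf
  rw [this, Complex.norm_exp_ofReal_mul_I]

lemma e_div_eq_stdAddChar {N : ℕ} [NeZero N] {m : ℕ} (hm : m ∣ N) (k l u v : ℕ) :
    e (((k : ℝ) * u + (l : ℝ) * v) / m) =
      stdAddChar ((k : ZMod N) * ((u * (N / m) : ℕ) : ZMod N) +
        (l : ZMod N) * ((v * (N / m) : ℕ) : ZMod N)) := by
  have hN : N ≠ 0 := NeZero.ne N
  have hm0 : (m : ℂ) ≠ 0 := by
    rintro h
    rw [Nat.cast_eq_zero] at h
    exact hN (Nat.eq_zero_of_zero_dvd (h ▸ hm))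
  have hN' : (N : ℂ) ≠ 0 := by exact_mod_cast hN
  have e1 : (k : ZMod N) * ((u * (N / m) : ℕ) : ZMod N) +
      (l : ZMod N) * ((v * (N / m) : ℕ) : ZMod N) =
      (((k * (u * (N / m)) + l * (v * (N / m)) : ℕ) : ℤ) : ZMod N) := by
    rw [Int.cast_natCast]; push_cast; rfl
  rw [e1, stdAddChar_coe, e, Int.cast_natCast]
  push_cast [Nat.cast_div hm hm0]
  congr 1
  field_simp

/-! ### Small and large `M` -/

/-- The bound from the Cauchy–Schwarz inequality. -/
lemma norm_sq_sum_e_le (K L : ℕ) (a : ℕ → ℕ → ℂ) (x : ℕ → ℕ → ℝ) :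
    ‖∑ k ∈ Finset.Icc 1 K, ∑ l ∈ Finset.Icc 1 L, a k l * e (x k l)‖ ^ 2 ≤
      K * L * ∑ k ∈ Finset.Icc 1 K, ∑ l ∈ Finset.Icc 1 L, ‖a k l‖ ^ 2 := by
  rw [← Finset.sum_product', ← Finset.sum_product']
  calc _ ≤ (∑ z ∈ Finset.Icc 1 K ×ˢ Finset.Icc 1 L, ‖a z.1 z.2‖) ^ 2 := by
        gcongr
        refine (norm_sum_le _ _).trans (le_of_eq ?_)
        simp only [norm_mul, norm_e, mul_one]
    _ ≤ _ := by
        refine sq_sum_le_card_mul_sum_sq.trans (le_of_eq ?_)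
        simp

/-- At most 104 moduli with at most 104 roots each; `10816 = 104²`. -/
lemma sum_roots_le_of_le {M : ℝ} (hM : M ≤ 52) (K L : ℕ) (a : ℕ → ℕ → ℂ) :
    ∑ m ∈ Finset.Ioc ⌊M⌋₊ ⌊2 * M⌋₊, ∑ ν ∈ roots m,
      ‖∑ k ∈ Finset.Icc 1 K, ∑ l ∈ Finset.Icc 1 L,
        a k l * e (((k : ℝ) * (ν : ℝ) + (l : ℝ) * (ν : ℝ) ^ 2) / (m : ℝ))‖ ^ 2 ≤
      10816 * (K * L) * ∑ k ∈ Finset.Icc 1 K, ∑ l ∈ Finset.Icc 1 L, ‖a k l‖ ^ 2 := by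
  set Q : ℝ := K * L * ∑ k ∈ Finset.Icc 1 K, ∑ l ∈ Finset.Icc 1 L, ‖a k l‖ ^ 2 with hQ
  have hQ0 : 0 ≤ Q := by positivity
  have hfl : ⌊2 * M⌋₊ ≤ 104 := Nat.floor_le_of_le (by norm_num; linarith)
  calc _ ≤ ∑ m ∈ Finset.Ioc ⌊M⌋₊ ⌊2 * M⌋₊, ∑ ν ∈ roots m, Q :=
        Finset.sum_le_sum fun m _ => Finset.sum_le_sum fun ν _ => norm_sq_sum_e_le K L a _
    _ ≤ ∑ m ∈ Finset.Ioc ⌊M⌋₊ ⌊2 * M⌋₊, 104 * Q := by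
        refine Finset.sum_le_sum fun m hm => ?_
        rw [Finset.sum_const, nsmul_eq_mul]
        gcongr
        have h1 : (roots m).card ≤ m := by
          simpa [roots] using Finset.card_filter_le (Finset.range m) (fun ν => ν ^ 3 ≡ 2 [MOD m])
        have h2 := (Finset.mem_Ioc.mp hm).2
        exact_mod_cast (by omega : (roots m).card ≤ 104)
    _ ≤ 104 * (104 * Q) := by
        rw [Finset.sum_const, nsmul_eq_mul]
        gcongr
        rw [Nat.card_Ioc]
        exact_mod_cast (by omega : ⌊2 * M⌋₊ - ⌊M⌋₊ ≤ 104)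
    _ = _ := by rw [hQ]; ring

lemma sum_roots_le_of_lt {M : ℝ} (hM : 52 < M) (K L : ℕ) (a : ℕ → ℕ → ℂ) :
    ∑ m ∈ Finset.Ioc ⌊M⌋₊ ⌊2 * M⌋₊, ∑ ν ∈ roots m,
      ‖∑ k ∈ Finset.Icc 1 K, ∑ l ∈ Finset.Icc 1 L,
        a k l * e (((k : ℝ) * (ν : ℝ) + (l : ℝ) * (ν : ℝ) ^ 2) / (m : ℝ))‖ ^ 2 ≤
      16 * ((⌈M⌉₊ + 6 * K : ℕ) : ℝ) * ((⌈M⌉₊ + 6 * L : ℕ) : ℝ) *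
        ∑ k ∈ Finset.Icc 1 K, ∑ l ∈ Finset.Icc 1 L, ‖a k l‖ ^ 2 := by
  have hM0 : 0 < M := by linarith
  have hc : 0 < ⌈M⌉₊ := Nat.ceil_pos.mpr hM0
  -- The summand `⌈M⌉₊` keeps the box side `1/A` within the spacing `1/M`; `6 * K` ensures `6KT ≤
  -- N`.
  set A : ℕ := ⌈M⌉₊ + 6 * K with hA
  set B : ℕ := ⌈M⌉₊ + 6 * L with hB
  -- The factorial makes every modulus divide `N`. Its size is harmless: only `N/T = A` and `N/U =
  -- B` enter the bound.
  set D : ℕ := (⌊2 * M⌋₊).factorial with hD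
  have hA0 : 0 < A := by omega
  have hB0 : 0 < B := by omega
  have hD0 : 0 < D := Nat.factorial_pos _
  have hMA : 1 / (A : ℝ) ≤ 1 / M := by
    gcongr
    exact (Nat.le_ceil M).trans (by exact_mod_cast (by omega : ⌈M⌉₊ ≤ A))
  have hMB : 1 / (B : ℝ) ≤ 1 / M := by
    gcongr
    exact (Nat.le_ceil M).trans (by exact_mod_cast (by omega : ⌈M⌉₊ ≤ B))
  obtain ⟨T, hT⟩ : ∃ T, T = D * B := ⟨_, rfl⟩
  obtain ⟨U, hU⟩ : ∃ U, U = D * A := ⟨_, rfl⟩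
  obtain ⟨N, hN⟩ : ∃ N, N = D * A * B := ⟨_, rfl⟩
  have hNT : N = T * A := by rw [hN, hT]; ring
  have hNU : N = U * B := by rw [hN, hU]
  have hT0 : 0 < T := by rw [hT]; positivity
  have hU0 : 0 < U := by rw [hU]; positivity
  have hN0 : 0 < N := by rw [hN]; positivity
  have : NeZero N := ⟨hN0.ne'⟩
  have hTN : T ≤ N := by rw [hNT]; exact Nat.le_mul_of_pos_right _ hA0
  have hUN : U ≤ N := by rw [hNU]; exact Nat.le_mul_of_pos_right _ hB0
  have hdvd : ∀ m ∈ Finset.Ioc ⌊M⌋₊ ⌊2 * M⌋₊, m ∣ N := by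
    intro m hm
    rw [Finset.mem_Ioc] at hm
    rw [hN, mul_assoc]
    exact (Nat.dvd_factorial (by omega) hm.2).mul_right _
  have hrange : ∀ m ∈ Finset.Ioc ⌊M⌋₊ ⌊2 * M⌋₊, M < ((m : ℤ) : ℝ) ∧ ((m : ℤ) : ℝ) ≤ 2 * M := by
    intro m hm
    rw [Finset.mem_Ioc] at hm
    rw [Int.cast_natCast]
    exact ⟨(Nat.floor_lt hM0.le).mp hm.1, (Nat.le_floor_iff (by linarith)).mp hm.2⟩
  set S : Finset (Σ _ : ℕ, ℕ) := (Finset.Ioc ⌊M⌋₊ ⌊2 * M⌋₊).sigma roots with hS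
  have key := large_sieve_zmod (K := K) (L := L) hT0 hU0
    (by rw [hNT, mul_comm]; gcongr; omega) (by rw [hNU, mul_comm]; gcongr; omega) S
    (fun s => ((s.2 * (N / s.1) : ℕ) : ZMod N)) (fun s => ((s.2 ^ 2 * (N / s.1) : ℕ) : ZMod N))
    (by
      rintro ⟨⟨m, ν⟩, t, u⟩ h1 ⟨⟨w, μ⟩, t', u'⟩ h2 h
      simp only [hS, Finset.coe_product, Set.mem_prod, Finset.mem_coe, Finset.mem_sigma,
        Finset.mem_range] at h1 h2
      obtain ⟨⟨hm, hν⟩, ht, hu⟩ := h1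
      obtain ⟨⟨hw, hμ⟩, ht', hu'⟩ := h2
      simp only [Prod.mk.injEq] at h
      obtain ⟨hx, hy⟩ := h
      obtain ⟨i, hi⟩ := exists_int_close_of_add_eq hNT hN0 (hdvd m hm) (hdvd w hw) ht ht' hx
      obtain ⟨j, hj⟩ := exists_int_close_of_add_eq hNU hN0 (hdvd m hm) (hdvd w hw) hu hu' hy
      obtain ⟨hmw, hd⟩ := root_spacing hM (hrange m hm).1 (hrange m hm).2 (hrange w hw).1
        (hrange w hw).2 (dvd_of_mem_roots hν) (dvd_of_mem_roots hμ) i j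
        (by push_cast; exact hi.trans hMA) (by push_cast at hj ⊢; exact hj.trans hMB)
      obtain rfl : m = w := by exact_mod_cast hmw
      have hν' : ν < m := Finset.mem_range.mp (Finset.mem_filter.mp hν).1
      have hμ' : μ < m := Finset.mem_range.mp (Finset.mem_filter.mp hμ).1
      have h0 : (ν : ℤ) - μ = 0 := Int.eq_zero_of_abs_lt_dvd hd (by rw [abs_lt]; omega)
      obtain rfl : ν = μ := by omega
      rw [natCast_add_left_cancel hTN ht ht' hx, natCast_add_left_cancel hUN hu hu' hy]) a
  have hNTA : (N : ℝ) / T = A := by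
    have : (T : ℝ) ≠ 0 := by exact_mod_cast hT0.ne'
    rw [hNT]; push_cast; field_simp
  have hNUB : (N : ℝ) / U = B := by
    have : (U : ℝ) ≠ 0 := by exact_mod_cast hU0.ne'
    rw [hNU]; push_cast; field_simp
  rw [hNTA, hNUB] at key
  refine le_trans (le_of_eq ?_) key
  rw [hS, Finset.sum_sigma]
  refine Finset.sum_congr rfl fun m hm => Finset.sum_congr rfl fun ν _ => ?_
  congr 2
  refine Finset.sum_congr rfl fun k _ => Finset.sum_congr rfl fun l _ => ?_
  rw [← e_div_eq_stdAddChar (hdvd m hm)]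
  push_cast
  rfl

end CubicSieve

theorem theorem3 :
    ∃ C : ℝ, 0 < C ∧ ∀ M K L : ℝ, 0 < M → 0 < K → 0 < L → ∀ a : ℕ → ℕ → ℂ,
      ∑ m ∈ Finset.Ioc ⌊M⌋₊ ⌊2 * M⌋₊, ∑ ν ∈ CubicSieve.roots m,
          ‖∑ k ∈ Finset.Icc 1 ⌊K⌋₊, ∑ l ∈ Finset.Icc 1 ⌊L⌋₊,
            a k l * CubicSieve.e (((k : ℝ) * (ν : ℝ) + (l : ℝ) * (ν : ℝ) ^ 2) / (m : ℝ))‖ ^ 2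
        ≤ C * ((M + K) * (M + L)) *
          ∑ k ∈ Finset.Icc 1 ⌊K⌋₊, ∑ l ∈ Finset.Icc 1 ⌊L⌋₊, ‖a k l‖ ^ 2 := by
  refine ⟨10816, by norm_num, fun M K L hM hK hL a => ?_⟩
  have hK' := Nat.floor_le hK.le
  have hL' := Nat.floor_le hL.le
  rcases le_or_gt M 52 with h | h
  · refine (CubicSieve.sum_roots_le_of_le h _ _ a).trans ?_
    gcongr <;> linarith
  · refine (CubicSieve.sum_roots_le_of_lt h _ _ a).trans ?_
    -- As `M > 52`, `⌈M⌉₊ ≤ M + 1 ≤ 6M`.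
    have hc := (Nat.ceil_lt_add_one hM.le).le
    have h1 : ((⌈M⌉₊ + 6 * ⌊K⌋₊ : ℕ) : ℝ) ≤ 6 * (M + K) := by push_cast; linarith
    have h2 : ((⌈M⌉₊ + 6 * ⌊L⌋₊ : ℕ) : ℝ) ≤ 6 * (M + L) := by push_cast; linarith
    refine mul_le_mul_of_nonneg_right ?_ (by positivity)
    calc (16 : ℝ) * ((⌈M⌉₊ + 6 * ⌊K⌋₊ : ℕ) : ℝ) * ((⌈M⌉₊ + 6 * ⌊L⌋₊ : ℕ) : ℝ)
        ≤ 16 * (6 * (M + K)) * (6 * (M + L)) := by gcongr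
      _ = 576 * ((M + K) * (M + L)) := by ring
      _ ≤ 10816 * ((M + K) * (M + L)) := by gcongr; norm_num
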